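/- Let $X\subseteq\mathbb R^n$ be convex, let $C\subseteq\mathbb R^q$ be a pointed convex cone (containing $0$ and no line), let $F\colon X\to\mathbb R^q$ be $C$-convex, i.e. $\lambda F(x)+(1-\lambda)F(y)-F(\lambda x+(1-\lambda)y)\in C$ for all $x,y\in X$ and $\lambda\in[0,1]$, and let $g=(g_1,\dots,g_m)^{\mathsf T}$ with convex functions $g_i\colon\mathbb R^n\to\mathbb R\cup\{\infty\}$. Put $S=\{x\in X\mid g(x)\le 0\}$, $\operatorname{dom}g=\bigcap_{i=1}^m\{x\mid g_i(x)<\infty\}$, $C^+=\{w\in\mathbb R^q\mid w^{\mathsf T}y\ge 0\ \text{for all } y\in C\}$ and $\mathcal P=\operatorname{cl}(F[S]+C)$. Assume: (A1) $F$ is continuous on $X$; (A2) every $g_i$ is proper and lower semicontinuous, and its domain is relatively open; (A3) $\bigcap_{i=1}^m\operatorname{ri}\{x\in X\mid g_i(x)\le 0\}\neq\emptyset$, where $\operatorname{ri}$ denotes the relative interior; (A4) $S$ is bounded; (A5) $C$ has nonempty interior and $C=\{y\in\mathbb R^q\mid Z^{\mathsf T}y\ge 0\}$ for a matrix $Z\in\mathbb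 R^{q\times\ell}$. Assume moreover that $S$ is closed and that for every $i=1,\dots,m$ the set $\{x\in X\mid g_i(x)<0\}$ is nonempty. Let $p\in\operatorname{int}\mathcal P$. Then for every $v\in\mathbb R^q\setminus\mathcal P$ and $c:=p-v$, the problem $$\min\ z\quad\text{s.t.}\quad x\in X,\ z\in\mathbb R,\ g(x)\le 0,\ Z^{\mathsf T}(F(x)-v-zc)\le 0\tag{P$_2(v,c)$}$$ has an optimal solution $(x^*,z^*)$, its Lagrangian dual problem $$\max\ \inf_{x\in X\cap\operatorname{dom}g}\{u^{\mathsf T}g(x)+w^{\mathsf T}F(x)\}-w^{\mathsf T}v\quad\text{s.t.}\quad u\in\mathbb R^m,\ u\ge 0,\ w^{\mathsf T}c=1,\ w\in C^+\tag{D$_2(v,c)$}$$ has an optimal solution $(u^*,w^*)$, and the optimal values of the two problems coincide. -/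

import Mathlib

open scoped Matrix

noncomputable section

/-- A function with values in the extended reals is convex if its epigraph is convex. -/
def ERealConvex {n : ℕ} (f : EuclideanSpace ℝ (Fin n) → EReal) : Prop :=
  Convex ℝ {p : EuclideanSpace ℝ (Fin n) × ℝ | f p.1 ≤ (p.2 : EReal)}

/-- The effective domain of a function with values in `ℝ ∪ {∞}`. -/
def effDom {n : ℕ} (f : EuclideanSpace ℝ (Fin n) → EReal) : Set (EuclideanSpace ℝ (Fin n)) :=
  {x | f x < ⊤}

/-- A function is proper if it never takes the value `-∞` and is not identically `∞`. -/
def ERealProper {n : ℕ} (f : EuclideanSpace ℝ (Fin n) → EReal) : Prop :=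
  (∀ x, f x ≠ ⊥) ∧ (effDom f).Nonempty

/-- The data of a vector convex program
`min F(x) w.r.t. ≤_C subject to g(x) ≤ 0`, with `n` variables, `q` objectives and `m`
constraints. The objective is a function on the convex set `X`; it is represented by a function
on the whole space, of which only the values on `X` are ever used. A cone is pointed, in the sense
of containing no line, if it is salient in the terminology of Mathlib. -/
structure VCP (n q m : ℕ) where
  X : Set (EuclideanSpace ℝ (Fin n))
  F : EuclideanSpace ℝ (Fin n) → EuclideanSpace ℝ (Fin q)
  C : ConvexCone ℝ (EuclideanSpace ℝ (Fin q))
  g : Fin m → EuclideanSpace ℝ (Fin n) → EReal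
  convex_X : Convex ℝ X
  zero_mem_C : (0 : EuclideanSpace ℝ (Fin q)) ∈ C
  salient_C : C.Salient
  /-- `F` is `C`-convex: `F (a x + (1 - a) y) ≤_C a F x + (1 - a) F y`. -/
  cconvex_F : ∀ x ∈ X, ∀ y ∈ X, ∀ a : ℝ, 0 ≤ a → a ≤ 1 →
    (a • F x + (1 - a) • F y) - F (a • x + (1 - a) • y) ∈ C
  g_ne_bot : ∀ i x, g i x ≠ ⊥
  convex_g : ∀ i, ERealConvex (g i)

namespace VCP

variable {n q m l : ℕ}

/-- The feasible set `S`. -/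
def feasibleSet (P : VCP n q m) : Set (EuclideanSpace ℝ (Fin n)) :=
  {x | x ∈ P.X ∧ ∀ i, P.g i x ≤ 0}

/-- The domain of `g`, the intersection of the domains of its components. -/
def domG (P : VCP n q m) : Set (EuclideanSpace ℝ (Fin n)) :=
  ⋂ i, effDom (P.g i)

/-- The upper image `cl (F[S] + C)`. -/
def upperImage (P : VCP n q m) : Set (EuclideanSpace ℝ (Fin q)) :=
  closure {y | ∃ x ∈ P.feasibleSet, ∃ d ∈ P.C, y = P.F x + d}

/-- The standing assumptions (A1)-(A5) on a vector convex program; the matrix `Z` provides the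
inequality description of the ordering cone. -/
structure Assumptions (P : VCP n q m) (Z : Matrix (Fin q) (Fin l) ℝ) : Prop where
  A1 : ContinuousOn P.F P.X
  A2 : ∀ i, ERealProper (P.g i) ∧ LowerSemicontinuous (P.g i) ∧
    intrinsicInterior ℝ (effDom (P.g i)) = effDom (P.g i)
  A3 : (⋂ i, intrinsicInterior ℝ {x | x ∈ P.X ∧ P.g i x ≤ 0}).Nonempty
  A4 : Bornology.IsBounded P.feasibleSet
  A5 : (interior (P.C : Set (EuclideanSpace ℝ (Fin q)))).Nonempty ∧
    (P.C : Set (EuclideanSpace ℝ (Fin q))) = {y | 0 ≤ Zᵀ *ᵥ y.ofLp}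

/-- Feasibility of `(x, z)` for the scalarization `P₂(v, c)`. -/
def P2Feasible (P : VCP n q m) (Z : Matrix (Fin q) (Fin l) ℝ) (v c : EuclideanSpace ℝ (Fin q))
    (x : EuclideanSpace ℝ (Fin n)) (z : ℝ) : Prop :=
  x ∈ P.X ∧ (∀ i, P.g i x ≤ 0) ∧ Zᵀ *ᵥ (P.F x - v - z • c).ofLp ≤ 0

/-- `(x, z)` is an optimal solution of `P₂(v, c)`. -/
def IsP2Solution (P : VCP n q m) (Z : Matrix (Fin q) (Fin l) ℝ) (v c : EuclideanSpace ℝ (Fin q))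
    (x : EuclideanSpace ℝ (Fin n)) (z : ℝ) : Prop :=
  P.P2Feasible Z v c x z ∧ ∀ x' z', P.P2Feasible Z v c x' z' → z ≤ z'

/-- The optimal value of `P₂(v, c)`, in the extended reals. -/
def p2Value (P : VCP n q m) (Z : Matrix (Fin q) (Fin l) ℝ) (v c : EuclideanSpace ℝ (Fin q)) :
    EReal :=
  sInf {t | ∃ x z, P.P2Feasible Z v c x z ∧ t = (z : EReal)}

/-- Feasibility of `(u, w)` for the dual problem `D₂(v, c)`: `u ≥ 0`, `wᵀ c = 1`, and `w` lies in
the dual cone `C⁺`. -/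
def D2Feasible (P : VCP n q m) (c : EuclideanSpace ℝ (Fin q))
    (u : EuclideanSpace ℝ (Fin m)) (w : EuclideanSpace ℝ (Fin q)) : Prop :=
  (∀ i, 0 ≤ u i) ∧ inner ℝ w c = 1 ∧
    w ∈ ProperCone.innerDual (P.C : Set (EuclideanSpace ℝ (Fin q)))

/-- The objective `inf {uᵀ g(x) + wᵀ F(x) | x ∈ X ∩ dom g} - wᵀ v` of the dual problem
`D₂(v, c)`, in the extended reals. On `dom g` every `g i x` is a real number. -/
def d2Objective (P : VCP n q m) (v : EuclideanSpace ℝ (Fin q))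
    (u : EuclideanSpace ℝ (Fin m)) (w : EuclideanSpace ℝ (Fin q)) : EReal :=
  (⨅ x ∈ P.X ∩ P.domG,
    (((∑ i, u i * (P.g i x).toReal) + inner ℝ w (P.F x) : ℝ) : EReal)) - ((inner ℝ w v : ℝ) : EReal)

/-- `(u, w)` is an optimal solution of `D₂(v, c)`. -/
def IsD2Solution (P : VCP n q m) (v c : EuclideanSpace ℝ (Fin q))
    (u : EuclideanSpace ℝ (Fin m)) (w : EuclideanSpace ℝ (Fin q)) : Prop :=
  P.D2Feasible c u w ∧ ∀ u' w', P.D2Feasible c u' w' → P.d2Objective v u' w' ≤ P.d2Objective v u w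

/-- The optimal value of `D₂(v, c)`, in the extended reals. -/
def d2Value (P : VCP n q m) (v c : EuclideanSpace ℝ (Fin q)) : EReal :=
  sSup {t | ∃ u w, P.D2Feasible c u w ∧ t = P.d2Objective v u w}

end VCP

end

open Set Filter Topology

/-! Put `c = p - v`. Since `F[S]` is compact and `C` is closed, `F[S] + C` is already closed, so the
primal asks for the least `z` with `v + z c` in the convex upper image; it exists because the line
through `v` and `p` cannot meet that image at a negative parameter without forcing `v` into it.

For the dual, `perturbationSet` is convex with nonempty interior, and at the optimal `z` the point
`(0, v + z c)` is not interior to it. A supporting functional there (`exists_multipliers`) has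
components `u ≥ 0` and `w ∈ C⁺`. The relative interior assumption yields a Slater point
(`exists_slater`), which excludes `w = 0`; interiority of `p` then gives `wᵀ c > 0`. Dividing by `wᵀ
c` produces a dual feasible pair with value at least `z`, and weak duality does the rest. -/

/-- A segment ending in a relative interior point can be prolonged inside the set. -/
theorem exists_prolongation_of_mem_intrinsicInterior {E : Type*} [NormedAddCommGroup E]
    [NormedSpace ℝ E] {s : Set E} {x y : E} (hx : x ∈ intrinsicInterior ℝ s) (hy : y ∈ s) :
    ∃ t : ℝ, 0 < t ∧ x + t • (x - y) ∈ s := by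
  obtain ⟨x', hx', rfl⟩ := mem_intrinsicInterior.1 hx
  have hmem : ∀ t : ℝ, (x' : E) + t • ((x' : E) - y) ∈ affineSpan ℝ s := fun t ↦ by
    have h := AffineSubspace.smul_vsub_vadd_mem _ t x'.2 (subset_affineSpan ℝ s hy) x'.2
    rwa [vsub_eq_sub, vadd_eq_add, add_comm] at h
  let φ : ℝ → affineSpan ℝ s := fun t ↦ ⟨(x' : E) + t • ((x' : E) - y), hmem t⟩
  have hφ : Continuous φ := by fun_prop
  have h0 : φ 0 = x' := Subtype.ext (by simp [φ])
  have hev : ∀ᶠ t in 𝓝 (0 : ℝ), φ t ∈ interior ((↑) ⁻¹' s : Set (affineSpan ℝ s)) :=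
    hφ.continuousAt (isOpen_interior.mem_nhds (by rwa [h0]))
  obtain ⟨t, ht, ht0⟩ :=
    ((hev.filter_mono nhdsWithin_le_nhds).and (self_mem_nhdsWithin (s := Ioi (0 : ℝ)))).exists
  have hts : φ t ∈ ((↑) ⁻¹' s : Set (affineSpan ℝ s)) := interior_subset ht
  exact ⟨t, ht0, hts⟩

theorem ERealConvex.le_combo {n : ℕ} {f : EuclideanSpace ℝ (Fin n) → EReal} (hf : ERealConvex f)
    {x y : EuclideanSpace ℝ (Fin n)} {r s a b : ℝ} (hx : f x ≤ r) (hy : f y ≤ s)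
    (ha : 0 ≤ a) (hb : 0 ≤ b) (hab : a + b = 1) :
    f (a • x + b • y) ≤ ((a * r + b * s : ℝ) : EReal) :=
  hf (x := (x, r)) hx (y := (y, s)) hy ha hb hab

namespace VCP

variable {n q m l : ℕ} (P : VCP n q m)

theorem add_mem_C {x y : EuclideanSpace ℝ (Fin q)} (hx : x ∈ P.C) (hy : y ∈ P.C) :
    x + y ∈ P.C :=
  P.C.add_mem hx hy

theorem smul_mem_C {x : EuclideanSpace ℝ (Fin q)} {a : ℝ} (ha : 0 ≤ a) (hx : x ∈ P.C) :
    a • x ∈ P.C := by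
  rcases ha.eq_or_lt with rfl | ha
  · simpa using P.zero_mem_C
  · exact P.C.smul_mem ha hx

variable {P} in
theorem combo_sub_mem_C {x y : EuclideanSpace ℝ (Fin n)} (hx : x ∈ P.X) (hy : y ∈ P.X)
    {r s : EuclideanSpace ℝ (Fin q)} (hr : r - P.F x ∈ P.C) (hs : s - P.F y ∈ P.C)
    {a b : ℝ} (ha : 0 ≤ a) (hb : 0 ≤ b) (hab : a + b = 1) :
    (a • r + b • s) - P.F (a • x + b • y) ∈ P.C := by
  have h := P.cconvex_F x hx y hy a ha (by linarith)
  obtain rfl : b = 1 - a := by linarith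
  have := P.add_mem_C (P.add_mem_C (P.smul_mem_C ha hr) (P.smul_mem_C hb hs)) h
  convert this using 1
  module

/-! ### The perturbation set and its supporting functionals -/

/-- Right-hand sides `(r, s)` for which the constraints `g x ≤ r`, `F x ≤_C s` are solvable
in `X`. -/
def perturbationSet : Set ((Fin m → ℝ) × EuclideanSpace ℝ (Fin q)) :=
  {a | ∃ x ∈ P.X, (∀ i, P.g i x ≤ (a.1 i : EReal)) ∧ a.2 - P.F x ∈ P.C}

theorem convex_perturbationSet : Convex ℝ P.perturbationSet := by
  rintro ⟨r, s⟩ ⟨x, hx, hgx, hFx⟩ ⟨r', s'⟩ ⟨y, hy, hgy, hFy⟩ a b ha hb hab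
  exact ⟨a • x + b • y, P.convex_X hx hy ha hb hab,
    fun i ↦ (P.convex_g i).le_combo (hgx i) (hgy i) ha hb hab,
    combo_sub_mem_C hx hy hFx hFy ha hb hab⟩

/-- One feasible `x` serves every strictly positive `r` and every `s ∈ F x + int C`, and these pairs
form an open set. -/
theorem nonempty_interior_perturbationSet {x : EuclideanSpace ℝ (Fin n)}
    (hx : x ∈ P.feasibleSet) (hC : (interior (P.C : Set (EuclideanSpace ℝ (Fin q)))).Nonempty) :
    (interior P.perturbationSet).Nonempty := by
  obtain ⟨d, hd⟩ := hC
  let U : Set ((Fin m → ℝ) × EuclideanSpace ℝ (Fin q)) :=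
    (univ.pi fun _ ↦ Ioi 0) ×ˢ ((fun s ↦ s - P.F x) ⁻¹' interior P.C)
  have hU : IsOpen U := (isOpen_set_pi finite_univ fun _ _ ↦ isOpen_Ioi).prod
    (isOpen_interior.preimage (by fun_prop))
  have hsub : U ⊆ P.perturbationSet := fun a ha ↦ ⟨x, hx.1, fun i ↦ (hx.2 i).trans
    (by exact_mod_cast (ha.1 i (mem_univ i)).le), interior_subset ha.2⟩
  exact ⟨(fun _ ↦ 1, d + P.F x), interior_maximal hsub hU ⟨fun _ _ ↦ by simp, by simpa using hd⟩⟩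

theorem zero_mem_perturbationSet_iff {y : EuclideanSpace ℝ (Fin q)} :
    ((0 : Fin m → ℝ), y) ∈ P.perturbationSet ↔ ∃ x ∈ P.feasibleSet, y - P.F x ∈ P.C := by
  simp [perturbationSet, feasibleSet, and_assoc]

/-- A boundary point of the convex perturbation set has a nonzero supporting functional, whose
components are nonnegative multipliers. -/
theorem exists_multipliers {x₀ : EuclideanSpace ℝ (Fin n)} (hx₀ : x₀ ∈ P.feasibleSet)
    (hC : (interior (P.C : Set (EuclideanSpace ℝ (Fin q)))).Nonempty)
    {y : EuclideanSpace ℝ (Fin q)} (hy : ∃ x ∈ P.feasibleSet, y - P.F x ∈ P.C)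
    (hint : ((0 : Fin m → ℝ), y) ∉ interior P.perturbationSet) :
    ∃ (u : EuclideanSpace ℝ (Fin m)) (w : EuclideanSpace ℝ (Fin q)),
      (u ≠ 0 ∨ w ≠ 0) ∧ (∀ i, 0 ≤ u i) ∧ (∀ d ∈ P.C, 0 ≤ inner ℝ w d) ∧
      ∀ a ∈ P.perturbationSet, inner ℝ w y ≤ ∑ i, u i * a.1 i + inner ℝ w a.2 := by
  obtain ⟨f, hf⟩ := geometric_hahn_banach_point_open P.convex_perturbationSet.interior
    isOpen_interior hint
  have hne := P.nonempty_interior_perturbationSet hx₀ hC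
  have hle : ∀ a ∈ P.perturbationSet, f (0, y) ≤ f a := fun a ha ↦ by
    -- Separation controls `f` on the interior only; a convex set with nonempty interior lies in the
    -- closure of that interior.
    have hcl : a ∈ closure (interior P.perturbationSet) := by
      rw [P.convex_perturbationSet.closure_interior_eq_closure_of_nonempty_interior hne]
      exact subset_closure ha
    exact closure_minimal (fun b hb ↦ (hf b hb).le)
      (isClosed_le continuous_const f.continuous) hcl
  let u : EuclideanSpace ℝ (Fin m) := WithLp.toLp 2 fun i ↦ f (Pi.single i 1, 0)
  let w : EuclideanSpace ℝ (Fin q) := (InnerProductSpace.toDual ℝ _).symm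
    (f.comp (ContinuousLinearMap.inr ℝ (Fin m → ℝ) (EuclideanSpace ℝ (Fin q))))
  have hw : ∀ s, inner ℝ w s = f (0, s) := fun s ↦ by
    simp [w, InnerProductSpace.toDual_symm_apply]
  have hu : ∀ r : Fin m → ℝ, f (r, 0) = ∑ i, u i * r i := fun r ↦ by
    have h := LinearMap.pi_apply_eq_sum_univ
      (f.comp (ContinuousLinearMap.inl ℝ (Fin m → ℝ) (EuclideanSpace ℝ (Fin q)))).toLinearMap r
    simp only [ContinuousLinearMap.coe_coe, ContinuousLinearMap.comp_apply,
      ContinuousLinearMap.inl_apply, smul_eq_mul] at h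
    rw [h]
    refine Finset.sum_congr rfl fun i _ ↦ ?_
    rw [mul_comm]
    congr 3
    ext j
    simp [Pi.single_apply, eq_comm]
  have hfa : ∀ a, f a = ∑ i, u i * a.1 i + inner ℝ w a.2 := fun a ↦ by
    rw [hw, ← hu, ← map_add]; simp
  obtain ⟨x, hx, hxy⟩ := hy
  refine ⟨u, w, ?_, fun i ↦ ?_, fun d hd ↦ ?_, fun a ha ↦ ?_⟩
  -- If both multipliers vanished, `f` would be zero, against its strict inequality on the interior.
  · by_contra! h
    obtain ⟨b, hb⟩ := hne
    have := hf b hb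
    simp [hfa, h.1, h.2] at this
  -- Relaxing a constraint, or adding an element of `C` as in the next case, stays in the set, so
  -- `f` cannot decrease in these directions.
  · have h := hle (Pi.single i 1, y) ⟨x, hx.1, fun j ↦ (hx.2 j).trans ?_, hxy⟩
    · simpa [hfa, Pi.single_apply] using h
    · have : (0 : ℝ) ≤ (Pi.single i 1 : Fin m → ℝ) j := by
        rw [Pi.single_apply]; split_ifs <;> norm_num
      exact_mod_cast this
  · have h := hle (0, y + d) (P.zero_mem_perturbationSet_iff.2 ⟨x, hx, ?_⟩)
    · simpa [hfa, inner_add_right] using h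
    · rw [add_sub_right_comm]
      exact P.add_mem_C hxy hd
  · have h := hle a ha
    rw [hfa, hfa a] at h
    simpa using h

/-! ### The upper image, Slater points and primal solutions -/

variable {P}

theorem Assumptions.isClosed_C {Z : Matrix (Fin q) (Fin l) ℝ} (hA : P.Assumptions Z) :
    IsClosed (P.C : Set (EuclideanSpace ℝ (Fin q))) := by
  rw [hA.A5.2]
  exact isClosed_le continuous_const
    (continuous_const.matrix_mulVec (PiLp.continuous_ofLp 2 _))

theorem Assumptions.mem_C_iff {Z : Matrix (Fin q) (Fin l) ℝ} (hA : P.Assumptions Z)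
    {y : EuclideanSpace ℝ (Fin q)} : y ∈ P.C ↔ 0 ≤ Zᵀ *ᵥ y.ofLp := by
  rw [← SetLike.mem_coe, hA.A5.2, mem_ofPred_eq]

theorem Assumptions.p2Feasible_iff {Z : Matrix (Fin q) (Fin l) ℝ} (hA : P.Assumptions Z)
    {v c : EuclideanSpace ℝ (Fin q)} {x : EuclideanSpace ℝ (Fin n)} {z : ℝ} :
    P.P2Feasible Z v c x z ↔ x ∈ P.feasibleSet ∧ v + z • c - P.F x ∈ P.C := by
  have h : v + z • c - P.F x = -(P.F x - v - z • c) := by abel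
  rw [hA.mem_C_iff, h, WithLp.ofLp_neg, Matrix.mulVec_neg, neg_nonneg, P2Feasible, feasibleSet,
    mem_ofPred_eq, and_assoc]

theorem Assumptions.mem_upperImage_iff {Z : Matrix (Fin q) (Fin l) ℝ} (hA : P.Assumptions Z)
    (hS : IsClosed P.feasibleSet) {y : EuclideanSpace ℝ (Fin q)} :
    y ∈ P.upperImage ↔ ∃ x ∈ P.feasibleSet, y - P.F x ∈ P.C := by
  open Pointwise in
  have hset : {y | ∃ x ∈ P.feasibleSet, ∃ d ∈ P.C, y = P.F x + d} =
      P.F '' P.feasibleSet + (P.C : Set (EuclideanSpace ℝ (Fin q))) := by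
    ext y
    simp [Set.mem_add, eq_comm]
  have hK : IsCompact (P.F '' P.feasibleSet) :=
    (Metric.isCompact_of_isClosed_isBounded hS hA.A4).image_of_continuousOn
      (hA.A1.mono fun _ hx ↦ hx.1)
  rw [upperImage, hset, (hA.isClosed_C.add_left_of_isCompact hK).closure_eq, ← hset]
  refine exists_congr fun x ↦ and_congr_right fun _ ↦ ⟨?_, fun h ↦ ⟨_, h, by abel⟩⟩
  rintro ⟨d, hd, rfl⟩
  simpa using hd

theorem Assumptions.convex_upperImage {Z : Matrix (Fin q) (Fin l) ℝ} (hA : P.Assumptions Z)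
    (hS : IsClosed P.feasibleSet) : Convex ℝ P.upperImage := by
  have h : P.upperImage = (fun y ↦ ((0 : Fin m → ℝ), y)) ⁻¹' P.perturbationSet := by
    ext y
    rw [hA.mem_upperImage_iff hS, mem_preimage, P.zero_mem_perturbationSet_iff]
  rw [h]
  exact P.convex_perturbationSet.linear_preimage
    (LinearMap.inr ℝ (Fin m → ℝ) (EuclideanSpace ℝ (Fin q)))

/-- Any `x` from (A3) works: the segment from a `y` with `g i y < 0` to `x` can be prolonged beyond
`x` within the `i`-th set, and convexity on the longer segment forces `g i x < 0`. -/
theorem Assumptions.exists_slater {Z : Matrix (Fin q) (Fin l) ℝ} (hA : P.Assumptions Z)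
    (hneg : ∀ i, ∃ x ∈ P.X, P.g i x < 0) {p : EuclideanSpace ℝ (Fin q)}
    (hp : p ∈ P.upperImage) :
    ∃ x ∈ P.X, ∀ i, P.g i x < 0 := by
  -- Without constraints the intersection in (A3) is the whole space and need not supply a point of
  -- `X`; a feasible point is used instead.
  rcases isEmpty_or_nonempty (Fin m) with hm | ⟨⟨j⟩⟩
  · obtain ⟨y, x, hx, -⟩ := closure_nonempty_iff.1 ⟨p, hp⟩
    exact ⟨x, hx.1, isEmptyElim⟩
  obtain ⟨x, hx⟩ := hA.A3
  rw [mem_iInter] at hx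
  refine ⟨x, (intrinsicInterior_subset (hx j)).1, fun i ↦ ?_⟩
  obtain ⟨y, hyX, hy⟩ := hneg i
  obtain ⟨t, ht, hz⟩ := exists_prolongation_of_mem_intrinsicInterior (hx i) ⟨hyX, hy.le⟩
  obtain ⟨r, hyr, hr⟩ := EReal.lt_iff_exists_real_btwn.1 hy
  have hr : r < 0 := by exact_mod_cast hr
  have h1 : 0 < 1 + t := by linarith
  have h := (P.convex_g i).le_combo hyr.le (s := 0) (by simpa using hz.2)
    (a := t / (1 + t)) (b := 1 / (1 + t)) (by positivity) (by positivity) (by field_simp; ring)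
  have hx' : (t / (1 + t)) • y + (1 / (1 + t)) • (x + t • (x - y)) = x := by
    match_scalars
    · field_simp
      ring
    · field_simp
  rw [hx'] at h
  refine h.trans_lt ?_
  have : t / (1 + t) * r + 1 / (1 + t) * 0 < 0 := by
    rw [mul_zero, add_zero]; exact mul_neg_of_pos_of_neg (by positivity) hr
  exact_mod_cast this

theorem Assumptions.exists_isP2Solution {Z : Matrix (Fin q) (Fin l) ℝ} (hA : P.Assumptions Z)
    (hS : IsClosed P.feasibleSet) {p v : EuclideanSpace ℝ (Fin q)} (hp : p ∈ P.upperImage)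
    (hv : v ∉ P.upperImage) :
    ∃ x z, P.IsP2Solution Z v (p - v) x z ∧ z ≤ 1 := by
  let T : Set ℝ := {z | v + z • (p - v) ∈ P.upperImage}
  have hT : IsClosed T := isClosed_closure.preimage (by fun_prop)
  have h1 : (1 : ℝ) ∈ T := by simpa [T] using hp
  -- For `z < 0`, `v` is a convex combination of `v + z (p - v)` and `p`, hence would lie in the
  -- upper image.
  have hbdd : BddBelow T := ⟨0, fun z hz ↦ by
    by_contra! hz0
    have h1z : 0 < 1 - z := by linarith
    have h := hA.convex_upperImage hS hz hp (a := 1 / (1 - z)) (b := -z / (1 - z))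
      (by positivity) (div_nonneg (by linarith) h1z.le) (by field_simp; ring)
    refine hv ?_
    convert h using 1
    match_scalars <;> field_simp <;> ring⟩
  obtain ⟨x, hx, hxC⟩ := (hA.mem_upperImage_iff hS).1 (hT.csInf_mem ⟨1, h1⟩ hbdd)
  refine ⟨x, sInf T, ⟨hA.p2Feasible_iff.2 ⟨hx, hxC⟩, fun x' z' h ↦ csInf_le hbdd ?_⟩,
    csInf_le hbdd h1⟩
  obtain ⟨hx', hz'⟩ := hA.p2Feasible_iff.1 h
  exact (hA.mem_upperImage_iff hS).2 ⟨x', hx', hz'⟩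

/-! ### Weak and strong duality -/

/-- Weak duality. -/
theorem Assumptions.d2Objective_le {Z : Matrix (Fin q) (Fin l) ℝ} (hA : P.Assumptions Z)
    {v c : EuclideanSpace ℝ (Fin q)} {x : EuclideanSpace ℝ (Fin n)} {z : ℝ}
    (hxz : P.P2Feasible Z v c x z) {u : EuclideanSpace ℝ (Fin m)} {w : EuclideanSpace ℝ (Fin q)}
    (huw : P.D2Feasible c u w) : P.d2Objective v u w ≤ z := by
  obtain ⟨hx, hC⟩ := hA.p2Feasible_iff.1 hxz
  obtain ⟨hu, hwc, hw⟩ := huw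
  have hdom : x ∈ P.X ∩ P.domG :=
    ⟨hx.1, mem_iInter.2 fun i ↦ (hx.2 i).trans_lt EReal.zero_lt_top⟩
  have hsum : ∑ i, u i * (P.g i x).toReal ≤ 0 := Finset.sum_nonpos fun i _ ↦
    mul_nonpos_of_nonneg_of_nonpos (hu i) (EReal.toReal_nonpos (hx.2 i))
  have hwF := ProperCone.mem_innerDual.1 hw hC
  rw [real_inner_comm, inner_sub_right, inner_add_right, inner_smul_right, hwc] at hwF
  refine EReal.sub_le_of_le_add ((iInf₂_le x hdom).trans ?_)
  rw [← EReal.coe_add]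
  exact EReal.coe_le_coe_iff.2 (by linarith)

/-- Strong duality: the dual attains the optimal value of the primal. -/
theorem Assumptions.exists_le_d2Objective {Z : Matrix (Fin q) (Fin l) ℝ} (hA : P.Assumptions Z)
    (hS : IsClosed P.feasibleSet) (hneg : ∀ i, ∃ x ∈ P.X, P.g i x < 0)
    {p v : EuclideanSpace ℝ (Fin q)} (hp : p ∈ interior P.upperImage)
    {x : EuclideanSpace ℝ (Fin n)} {z : ℝ} (hxz : P.IsP2Solution Z v (p - v) x z) (hz : z ≤ 1) :
    ∃ u w, P.D2Feasible (p - v) u w ∧ (z : EReal) ≤ P.d2Objective v u w := by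
  obtain ⟨hx, hxC⟩ := hA.p2Feasible_iff.1 hxz.1
  obtain ⟨x₀, hx₀, hg₀⟩ := hA.exists_slater hneg (interior_subset hp)
  -- Otherwise a slightly smaller parameter than `z` would still be feasible.
  have hint : ((0 : Fin m → ℝ), v + z • (p - v)) ∉ interior P.perturbationSet := fun h ↦ by
    let φ : ℝ → (Fin m → ℝ) × EuclideanSpace ℝ (Fin q) := fun t ↦ (0, v + t • (p - v))
    have hφ : Continuous φ := by fun_prop
    have hev : ∀ᶠ t in 𝓝 z, φ t ∈ interior P.perturbationSet :=
      hφ.continuousAt (isOpen_interior.mem_nhds h)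
    obtain ⟨t, ht, htz⟩ :=
      ((hev.filter_mono nhdsWithin_le_nhds).and (self_mem_nhdsWithin (s := Iio z))).exists
    obtain ⟨x', hx', hx'C⟩ := P.zero_mem_perturbationSet_iff.1 (interior_subset ht)
    exact (hxz.2 x' t (hA.p2Feasible_iff.2 ⟨hx', hx'C⟩)).not_gt htz
  obtain ⟨u, w, hne, hu, hw, hle⟩ := P.exists_multipliers hx hA.A5.1 ⟨x, hx, hxC⟩ hint
  have hdom : ∀ x ∈ P.X ∩ P.domG, inner ℝ w (v + z • (p - v)) ≤
      ∑ i, u i * (P.g i x).toReal + inner ℝ w (P.F x) := fun x hx ↦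
    hle (fun i ↦ (P.g i x).toReal, P.F x) ⟨x, hx.1, fun i ↦
      (EReal.coe_toReal (mem_iInter.1 hx.2 i).ne (P.g_ne_bot i x)).ge,
      by simpa using P.zero_mem_C⟩
  -- With `w = 0` the support inequality at the Slater point reads `0 ≤ uᵀ g(x₀)`, which is negative
  -- for nonzero `u ≥ 0`.
  have hw0 : w ≠ 0 := fun h0 ↦ by
    have hu0 : u ≠ 0 := hne.resolve_right (not_not.2 h0)
    obtain ⟨j, hj⟩ : ∃ j, u j ≠ 0 := by
      by_contra! h
      exact hu0 (by ext j; simpa using h j)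
    have h := hdom x₀ ⟨hx₀, mem_iInter.2 fun i ↦ (hg₀ i).trans EReal.zero_lt_top⟩
    have hgneg : ∀ i, (P.g i x₀).toReal < 0 := fun i ↦ by
      have h1 := hg₀ i
      rw [← EReal.coe_toReal ((hg₀ i).trans EReal.zero_lt_top).ne (P.g_ne_bot i x₀)] at h1
      exact_mod_cast h1
    simp only [h0, inner_zero_left, add_zero] at h
    refine h.not_gt (Finset.sum_neg' (fun i _ ↦
      mul_nonpos_of_nonneg_of_nonpos (hu i) (hgneg i).le) ⟨j, Finset.mem_univ j, ?_⟩)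
    exact mul_neg_of_pos_of_neg ((hu j).lt_of_ne hj.symm) (hgneg j)
  -- For small `t > 0` the point `p - t w` is in the upper image, so the support inequality gives `t
  -- ‖w‖² ≤ (1 - z) wᵀ (p - v)`; here `z ≤ 1` fixes the sign.
  have hpos : 0 < inner ℝ w (p - v) := by
    let φ : ℝ → EuclideanSpace ℝ (Fin q) := fun t ↦ p - t • w
    have hφ : Continuous φ := by fun_prop
    have hev : ∀ᶠ t in 𝓝 (0 : ℝ), φ t ∈ interior P.upperImage :=
      hφ.continuousAt (isOpen_interior.mem_nhds (by simpa [φ] using hp))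
    obtain ⟨t, ht, ht0⟩ :=
      ((hev.filter_mono nhdsWithin_le_nhds).and (self_mem_nhdsWithin (s := Ioi (0 : ℝ)))).exists
    have h := hle (0, φ t) (P.zero_mem_perturbationSet_iff.2
      ((hA.mem_upperImage_iff hS).1 (interior_subset ht)))
    have hww : 0 < t * inner ℝ w w := mul_pos ht0 (real_inner_self_pos.2 hw0)
    simp only [Pi.zero_apply, mul_zero, Finset.sum_const_zero, zero_add, φ, inner_add_right,
      inner_sub_right, inner_smul_right] at h
    rw [inner_sub_right]
    by_contra! hc
    nlinarith
  set k : ℝ := inner ℝ w (p - v) with hk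
  refine ⟨k⁻¹ • u, k⁻¹ • w, ⟨fun i ↦ mul_nonneg (inv_nonneg.2 hpos.le) (hu i), ?_, ?_⟩, ?_⟩
  · rw [real_inner_smul_left, ← hk, inv_mul_cancel₀ hpos.ne']
  · refine ProperCone.mem_innerDual.2 fun d hd ↦ ?_
    rw [real_inner_comm, real_inner_smul_left]
    exact mul_nonneg (inv_nonneg.2 hpos.le) (hw d hd)
  · refine EReal.le_sub_iff_add_le (by simp) (by simp) |>.2 (le_iInf₂ fun y hy ↦ ?_)
    rw [← EReal.coe_add]
    refine EReal.coe_le_coe_iff.2 ?_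
    have h := mul_le_mul_of_nonneg_left (hdom y hy) (inv_nonneg.2 hpos.le)
    rw [inner_add_right, inner_smul_right, ← hk, mul_add, mul_add, Finset.mul_sum,
      mul_left_comm, inv_mul_cancel₀ hpos.ne', mul_one] at h
    simp only [real_inner_smul_left, PiLp.smul_apply, smul_eq_mul, mul_assoc]
    linarith

end VCP

theorem proposition3p7 {n q m l : ℕ} (P : VCP n q m) (Z : Matrix (Fin q) (Fin l) ℝ)
    (hA : P.Assumptions Z)
    (hclosed : IsClosed P.feasibleSet)
    (hneg : ∀ i, ∃ x ∈ P.X, P.g i x < 0)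
    (p : EuclideanSpace ℝ (Fin q)) (hp : p ∈ interior P.upperImage)
    (v : EuclideanSpace ℝ (Fin q)) (hv : v ∉ P.upperImage) :
    (∃ x z, P.IsP2Solution Z v (p - v) x z) ∧
    (∃ u w, P.IsD2Solution v (p - v) u w) ∧
    P.p2Value Z v (p - v) = P.d2Value v (p - v) := by
  obtain ⟨x, z, hxz, hz⟩ := hA.exists_isP2Solution hclosed (interior_subset hp) hv
  obtain ⟨u, w, huw, hle⟩ := hA.exists_le_d2Objective hclosed hneg hp hxz hz
  refine ⟨⟨x, z, hxz⟩, ⟨u, w, huw, fun u' w' h ↦ (hA.d2Objective_le hxz.1 h).trans hle⟩, ?_⟩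
  have hp2 : P.p2Value Z v (p - v) = z := by
    refine IsLeast.csInf_eq ⟨⟨x, z, hxz.1, rfl⟩, ?_⟩
    rintro _ ⟨x', z', h, rfl⟩
    exact EReal.coe_le_coe_iff.2 (hxz.2 x' z' h)
  have hd2 : P.d2Value v (p - v) = z := by
    refine IsGreatest.csSup_eq ⟨⟨u, w, huw, hle.antisymm (hA.d2Objective_le hxz.1 huw)⟩, ?_⟩
    rintro _ ⟨u', w', h, rfl⟩
    exact hA.d2Objective_le hxz.1 h
  rw [hp2, hd2]
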